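/- Let $A \in \mathbb{R}^{m\times n}$ be an entrywise nonnegative matrix. A real symmetric matrix $M$ is called copositive if $x^{T} M x \ge 0$ for every entrywise nonnegative vector $x$, and completely positive if $M = BB^{T}$ for some entrywise nonnegative matrix $B$. Let $\nu_+(A)$ be the optimal value of the program $$\nu_+(A) = \max_{W \in \mathbb{R}^{m\times n}} \left\{ \langle A, W\rangle \;:\; \begin{bmatrix} I & -W \\ -W^{T} & I \end{bmatrix} \text{ copositive} \right\}, \qquad \langle A, W\rangle = \sum_{i,j} A_{ij} W_{ij}.$$ Then the following three quantities are equal to $\nu_+(A)$, and the two minima and the maximum are attained: (1) $\displaystyle \min \left\{ \sum_{i} \|u_i\|_2 \|v_i\|_2 \;:\; A = \sum_{i} u_i v_i^{T},\ u_i \in \mathbb{R}^m,\ v_i \in \mathbb{R}^n,\ u_i, v_i \ge 0 \right\}$, where the sums are finite, with any number of terms, and $u_i, v_i \ge 0$ is entrywise; (2) $\displaystyle \min_{X \in \mathbb{R}^{m\times m},\, Y \in \mathbb{R}^{n\times n}} \left\{ \tfrac12 (\operatorname{tr} X + \operatorname{tr} Y) \;:\; \begin{bmatrix} X & A \\ A^{T}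 & Y \end{bmatrix} \text{ completely positive} \right\}$; (3) $\displaystyle \max_{W \in \mathbb{R}^{m\times n}} \left\{ \langle A, W\rangle \;:\; \begin{bmatrix} I & -W \\ -W^{T} & I \end{bmatrix} \text{ copositive} \right\}$. -/

import Mathlib

/-- A real symmetric matrix `M` is copositive if `xᵀ M x ≥ 0` for every entrywise nonnegative `x`. -/
def Matrix.IsCopositive {ι : Type*} [Fintype ι] (M : Matrix ι ι ℝ) : Prop :=
  M.IsSymm ∧ ∀ x : ι → ℝ, (∀ i, 0 ≤ x i) → 0 ≤ x ⬝ᵥ M.mulVec x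

/-- A real matrix `M` is completely positive if `M = B Bᵀ` for some entrywise nonnegative `B`
with finitely many columns. -/
def Matrix.IsCompletelyPositive {ι : Type*} (M : Matrix ι ι ℝ) : Prop :=
  ∃ (r : ℕ) (B : Matrix ι (Fin r) ℝ), (∀ i k, 0 ≤ B i k) ∧ M = B * B.transpose

/-- The values `∑ₖ ‖uₖ‖₂ ‖vₖ‖₂` over all finite decompositions `A = ∑ₖ uₖ vₖᵀ` with entrywise
nonnegative vectors `uₖ`, `vₖ`. -/
def nonnegNuclearValues {m n : ℕ} (A : Matrix (Fin m) (Fin n) ℝ) : Set ℝ :=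
  {t | ∃ (r : ℕ) (u : Fin r → EuclideanSpace ℝ (Fin m)) (v : Fin r → EuclideanSpace ℝ (Fin n)),
    (∀ k i, 0 ≤ u k i) ∧ (∀ k j, 0 ≤ v k j) ∧
    A = ∑ k, Matrix.vecMulVec (u k).ofLp (v k).ofLp ∧
    t = ∑ k, ‖u k‖ * ‖v k‖}

/-- The objective values of the completely positive program of `A`. -/
def completelyPositiveValues {m n : ℕ} (A : Matrix (Fin m) (Fin n) ℝ) : Set ℝ :=
  {t | ∃ (X : Matrix (Fin m) (Fin m) ℝ) (Y : Matrix (Fin n) (Fin n) ℝ),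
    (Matrix.fromBlocks X A A.transpose Y).IsCompletelyPositive ∧
    t = (1 / 2 : ℝ) * (X.trace + Y.trace)}

/-- The objective values `⟨A, W⟩ = ∑ᵢⱼ Aᵢⱼ Wᵢⱼ` of the copositive program of `A`. -/
def copositiveValues {m n : ℕ} (A : Matrix (Fin m) (Fin n) ℝ) : Set ℝ :=
  {t | ∃ W : Matrix (Fin m) (Fin n) ℝ,
    (Matrix.fromBlocks (1 : Matrix (Fin m) (Fin m) ℝ) (-W) (-W.transpose)
      (1 : Matrix (Fin n) (Fin n) ℝ)).IsCopositive ∧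
    t = ∑ i, ∑ j, A i j * W i j}

/-- `ν₊(A)`, the optimal value of the copositive program of `A`. -/
noncomputable def nuPlus {m n : ℕ} (A : Matrix (Fin m) (Fin n) ℝ) : ℝ :=
  sSup (copositiveValues A)

/-! Weak duality pairs the copositive form with each column of `B`. Rescaling `uₖ`, `vₖ` to equal
norms turns a decomposition into a completely positive block matrix of the same value. It remains to
find a decomposition and a feasible `W` with equal values. A cheapest decomposition exists because
the convex hull of the nonnegative unit rank-one matrices is compact (`exists_isLeast_atomicCone`).
A matching `W` comes from Hahn–Banach (`exists_dual_functional`). The cost is finite only on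
nonnegative matrices, and `A` may lie on the boundary of that orthant, so the cost is first extended
by inf-convolution with the entrywise `ℓ¹` norm. The extension does not lower the cost on the
orthant, since the cost is 1-Lipschitz there (`mem_atomicCone_of_l1_dist`); this rests on the
estimate `exists_split_le`. -/

/-- The convex hull of a compact set in a finite-dimensional space is compact. -/
theorem IsCompact.convexHull_of_finiteDimensional {E : Type*} [AddCommGroup E] [Module ℝ E]
    [TopologicalSpace E] [IsTopologicalAddGroup E] [ContinuousSMul ℝ E] [FiniteDimensional ℝ E]
    {s : Set E} (hs : IsCompact s) : IsCompact (convexHull ℝ s) := by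
  -- Carathéodory: boundedly many points suffice, so the hull is a finite union of continuous images
  -- of compact sets.
  have key : convexHull ℝ s = ⋃ k ∈ Set.Iic (Module.finrank ℝ E + 1),
      (fun p : (Fin k → ℝ) × (Fin k → E) => ∑ i, p.1 i • p.2 i) ''
        (stdSimplex ℝ (Fin k) ×ˢ Set.univ.pi fun _ => s) := by
    apply Set.Subset.antisymm
    · intro x hx
      obtain ⟨ι, _, z, w, hz, hind, hw, hw1, hx⟩ := eq_pos_convex_span_of_mem_convexHull hx
      let e := Fintype.equivFin ι
      refine Set.mem_biUnion (x := Fintype.card ι) ?_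
        ⟨(w ∘ e.symm, z ∘ e.symm), ⟨⟨fun i => (hw _).le, ?_⟩, fun i _ => hz ⟨_, rfl⟩⟩, ?_⟩
      · exact (hind.card_le_finrank_succ).trans
          (Nat.succ_le_succ (Submodule.finrank_le _))
      · simpa using (e.symm.sum_comp w).trans hw1
      · simpa using (e.symm.sum_comp fun i => w i • z i).trans hx
    · refine Set.iUnion₂_subset fun k _ => ?_
      rintro _ ⟨⟨w, z⟩, ⟨hw, hz⟩, rfl⟩
      exact (convex_convexHull ℝ s).sum_mem (fun i _ => hw.1 i) hw.2
        fun i _ => subset_convexHull ℝ s (hz i trivial)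
  rw [key]
  refine (Set.finite_Iic _).isCompact_biUnion fun k _ => ?_
  refine ((isCompact_stdSimplex ℝ (Fin k)).prod (isCompact_univ_pi fun _ => hs)).image ?_
  fun_prop

namespace NonnegNuclear

open Matrix

variable {ι κ : Type*} [Fintype ι] [Fintype κ]

/-! ### Costs of nonnegative decompositions -/

/-- The Euclidean norm of a plain vector. -/
noncomputable def euclNorm (u : ι → ℝ) : ℝ := √(u ⬝ᵥ u)

theorem euclNorm_nonneg (u : ι → ℝ) : 0 ≤ euclNorm u := Real.sqrt_nonneg _

theorem euclNorm_sq (u : ι → ℝ) : euclNorm u ^ 2 = u ⬝ᵥ u :=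
  Real.sq_sqrt (Finset.sum_nonneg fun i _ => mul_self_nonneg (u i))

theorem euclNorm_eq_zero {u : ι → ℝ} : euclNorm u = 0 ↔ u = 0 := by
  rw [← dotProduct_self_eq_zero, ← euclNorm_sq, sq_eq_zero_iff]

theorem euclNorm_smul {c : ℝ} (hc : 0 ≤ c) (u : ι → ℝ) : euclNorm (c • u) = c * euclNorm u := by
  rw [euclNorm, smul_dotProduct, dotProduct_smul, smul_eq_mul, smul_eq_mul, ← mul_assoc,
    Real.sqrt_mul (mul_self_nonneg c), Real.sqrt_mul_self hc, euclNorm]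

theorem euclNorm_eq_norm (u : EuclideanSpace ℝ ι) : euclNorm u.ofLp = ‖u‖ := by
  rw [EuclideanSpace.norm_eq, euclNorm]
  simp [dotProduct, sq]

theorem euclNorm_smul_add_single [DecidableEq ι] {p : ι → ℝ} {i : ι} (hp : p i = 0) (c : ℝ)
    {x : ℝ} (hx : 0 ≤ x) :
    euclNorm (x • p + Pi.single i c) = √((x * euclNorm p) ^ 2 + c ^ 2) := by
  rw [← euclNorm_smul hx, euclNorm_sq, euclNorm]
  simp [hp, sq]

/-- The additive monoid of pairs `(A, t)` for which `A` has a decomposition `∑ uₖ vₖᵀ` into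
nonnegative rank-one matrices with `∑ ‖uₖ‖ ‖vₖ‖ ≤ t`. -/
def atomicCone (ι κ : Type*) [Fintype ι] [Fintype κ] : AddSubmonoid (Matrix ι κ ℝ × ℝ) :=
  AddSubmonoid.closure {p | ∃ u v, (∀ i, 0 ≤ u i) ∧ (∀ j, 0 ≤ v j) ∧
    p.1 = vecMulVec u v ∧ euclNorm u * euclNorm v ≤ p.2}

theorem vecMulVec_mem_atomicCone {u : ι → ℝ} {v : κ → ℝ} (hu : ∀ i, 0 ≤ u i) (hv : ∀ j, 0 ≤ v j)
    {t : ℝ} (ht : euclNorm u * euclNorm v ≤ t) : (vecMulVec u v, t) ∈ atomicCone ι κ :=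
  AddSubmonoid.subset_closure ⟨u, v, hu, hv, rfl, ht⟩

theorem nonneg_of_mem_atomicCone {p : Matrix ι κ ℝ × ℝ} (h : p ∈ atomicCone ι κ) :
    (∀ i j, 0 ≤ p.1 i j) ∧ 0 ≤ p.2 := by
  induction h using AddSubmonoid.closure_induction with
  | mem p h =>
    obtain ⟨u, v, hu, hv, h1, h2⟩ := h
    refine ⟨fun i j => ?_, (mul_nonneg (euclNorm_nonneg u) (euclNorm_nonneg v)).trans h2⟩
    rw [h1]
    exact mul_nonneg (hu i) (hv j)
  | zero => exact ⟨fun _ _ => le_rfl, le_rfl⟩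
  | add p q _ _ hp hq => exact ⟨fun i j => add_nonneg (hp.1 i j) (hq.1 i j), add_nonneg hp.2 hq.2⟩

theorem smul_mem_atomicCone {p : Matrix ι κ ℝ × ℝ} (h : p ∈ atomicCone ι κ) {c : ℝ} (hc : 0 ≤ c) :
    c • p ∈ atomicCone ι κ := by
  induction h using AddSubmonoid.closure_induction with
  | mem p h =>
    obtain ⟨u, v, hu, hv, h1, h2⟩ := h
    refine AddSubmonoid.subset_closure
      ⟨c • u, v, fun i => mul_nonneg hc (hu i), hv, ?_, ?_⟩
    · rw [Prod.smul_fst, h1, smul_vecMulVec]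
    · rw [euclNorm_smul hc, mul_assoc]
      exact mul_le_mul_of_nonneg_left h2 hc
  | zero => rw [smul_zero]; exact zero_mem _
  | add p q _ _ hp hq => rw [smul_add]; exact add_mem hp hq

theorem mem_atomicCone_mono {B : Matrix ι κ ℝ} {s t : ℝ} (h : (B, s) ∈ atomicCone ι κ)
    (hst : s ≤ t) : (B, t) ∈ atomicCone ι κ := by
  have h0 : ((0 : Matrix ι κ ℝ), t - s) ∈ atomicCone ι κ := by
    have := vecMulVec_mem_atomicCone (u := (0 : ι → ℝ)) (v := (0 : κ → ℝ)) (fun _ => le_rfl)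
      (fun _ => le_rfl) (t := t - s) (by simp [euclNorm, hst])
    simpa using this
  simpa using add_mem h h0

/-! ### Lipschitz continuity of the cost -/

/-- The numerical estimate behind `vecMulVec_sub_single_mem_atomicCone`. -/
theorem exists_split_le {a b α β : ℝ} (ha : 0 ≤ a) (hb : 0 ≤ b) (hα : 0 ≤ α) (hβ : 0 ≤ β) :
    ∃ l : ℝ, 0 ≤ l ∧ l ≤ 1 ∧
      a * √((l * b) ^ 2 + β ^ 2) + √(((1 - l) * a) ^ 2 + α ^ 2) * b ≤
        √(a ^ 2 + α ^ 2) * √(b ^ 2 + β ^ 2) + α * β := by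
  have hS : √(a ^ 2 + α ^ 2) * √(b ^ 2 + β ^ 2) = √((a ^ 2 + α ^ 2) * (b ^ 2 + β ^ 2)) :=
    (Real.sqrt_mul (by positivity) _).symm
  set D := a * β + α * b with hD
  have hD0 : 0 ≤ D := by positivity
  rcases hD0.eq_or_lt with h | h
  · have h1 : a * β = 0 := by nlinarith [mul_nonneg ha hβ, mul_nonneg hα hb]
    refine ⟨0, le_rfl, zero_le_one, ?_⟩
    have h2 : √((0 * b) ^ 2 + β ^ 2) = β := by simp [Real.sqrt_sq hβ]
    rw [h2, h1]
    have h3 : b ≤ √(b ^ 2 + β ^ 2) := Real.le_sqrt_of_sq_le (by nlinarith)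
    have := mul_le_mul_of_nonneg_left h3 (Real.sqrt_nonneg (a ^ 2 + α ^ 2))
    simp only [sub_zero, one_mul, zero_add]
    nlinarith [mul_nonneg hα hβ]
  · have hl : a * β / D ≤ 1 := (div_le_one h).2 (by nlinarith [mul_nonneg hα hb])
    -- This `l` makes both radicals multiples of the same `Q`, with factors `β / D` and `α / D`, so
    -- the left side collapses to `Q`.
    refine ⟨a * β / D, by positivity, hl, ?_⟩
    set Q := √((a * b) ^ 2 + D ^ 2) with hQ
    have e1 : √((a * β / D * b) ^ 2 + β ^ 2) = β / D * Q := by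
      rw [show (a * β / D * b) ^ 2 + β ^ 2 = (β / D) ^ 2 * ((a * b) ^ 2 + D ^ 2) by
        field_simp, Real.sqrt_mul (sq_nonneg _), Real.sqrt_sq (by positivity)]
    have e2 : √(((1 - a * β / D) * a) ^ 2 + α ^ 2) = α / D * Q := by
      have : 1 - a * β / D = α * b / D := by
        rw [eq_div_iff h.ne', sub_mul, div_mul_cancel₀ _ h.ne', hD]; ring
      rw [this, show (α * b / D * a) ^ 2 + α ^ 2 = (α / D) ^ 2 * ((a * b) ^ 2 + D ^ 2) by
        field_simp, Real.sqrt_mul (sq_nonneg _), Real.sqrt_sq (by positivity)]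
    have e3 : a * (β / D * Q) + α / D * Q * b = Q := by
      have : a * (β / D * Q) + α / D * Q * b = (a * β + α * b) / D * Q := by ring
      rw [this, ← hD, div_self h.ne', one_mul]
    rw [e1, e2, e3, hS, hQ]
    set S := √((a ^ 2 + α ^ 2) * (b ^ 2 + β ^ 2)) with hSdef
    have hS2 : S ^ 2 = (a ^ 2 + α ^ 2) * (b ^ 2 + β ^ 2) := Real.sq_sqrt (by positivity)
    have hab : a * b ≤ S := Real.le_sqrt_of_sq_le (by
      have h1 := mul_nonneg (sq_nonneg a) (sq_nonneg β)
      have h2 := mul_nonneg (sq_nonneg α) (sq_nonneg b)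
      have h3 := mul_nonneg (sq_nonneg α) (sq_nonneg β)
      linarith)
    -- The squares differ by `2αβ(S + αβ - ab)`, which is nonnegative by `hab`.
    refine Real.sqrt_le_iff.2 ⟨by positivity, ?_⟩
    have hαβ := mul_nonneg hα hβ
    have := mul_le_mul_of_nonneg_left hab hαβ
    rw [add_sq S, hS2, hD]
    nlinarith [sq_nonneg (α * β)]

section DecidableEq

variable [DecidableEq ι] [DecidableEq κ]

/-- Deleting an entry `c` of a nonnegative rank-one matrix increases the cost by at most `c`. -/
theorem vecMulVec_sub_single_mem_atomicCone {u : ι → ℝ} {v : κ → ℝ} (hu : ∀ i, 0 ≤ u i)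
    (hv : ∀ j, 0 ≤ v j) (i : ι) (j : κ) :
    (vecMulVec u v - Matrix.single i j (u i * v j),
      euclNorm u * euclNorm v + u i * v j) ∈ atomicCone ι κ := by
  set p := Function.update u i 0 with hp
  set q := Function.update v j 0 with hq
  have hpi : p i = 0 := by simp [hp]
  have hqj : q j = 0 := by simp [hq]
  have hup : u = p + Pi.single i (u i) := by
    ext k; by_cases h : k = i
    · subst h; simp [hp]
    · simp [hp, h]
  have hvq : v = q + Pi.single j (v j) := by
    ext k; by_cases h : k = j
    · subst h; simp [hq]
    · simp [hq, h]
  have hp0 : ∀ k, 0 ≤ p k := fun k => by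
    by_cases h : k = i
    · subst h; simp [hp]
    · simp [hp, h, hu k]
  have hq0 : ∀ k, 0 ≤ q k := fun k => by
    by_cases h : k = j
    · subst h; simp [hq]
    · simp [hq, h, hv k]
  obtain ⟨l, hl0, hl1, hl⟩ := exists_split_le (euclNorm_nonneg p) (euclNorm_nonneg q) (hu i) (hv j)
  have hnu : euclNorm u = √(euclNorm p ^ 2 + u i ^ 2) := by
    have := euclNorm_smul_add_single hpi (u i) zero_le_one
    rwa [one_smul, one_mul, ← hup] at this
  have hnv : euclNorm v = √(euclNorm q ^ 2 + v j ^ 2) := by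
    have := euclNorm_smul_add_single hqj (v j) zero_le_one
    rwa [one_smul, one_mul, ← hvq] at this
  -- What remains is `p qᵀ + v j • p eⱼᵀ + u i • eᵢ qᵀ`; the term `p qᵀ` is shared between the other
  -- two in proportions `l` and `1 - l`.
  have m1 : (vecMulVec p (l • q + Pi.single j (v j)), euclNorm p * √((l * euclNorm q) ^ 2 + v j ^ 2))
      ∈ atomicCone ι κ := by
    refine vecMulVec_mem_atomicCone hp0 (fun k => ?_) (le_of_eq ?_)
    · exact add_nonneg (mul_nonneg hl0 (hq0 k)) ((Pi.single_nonneg (α := fun _ => ℝ)).2 (hv j) k)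
    · rw [euclNorm_smul_add_single hqj _ hl0]
  have m2 : (vecMulVec ((1 - l) • p + Pi.single i (u i)) q,
      √(((1 - l) * euclNorm p) ^ 2 + u i ^ 2) * euclNorm q) ∈ atomicCone ι κ := by
    refine vecMulVec_mem_atomicCone (fun k => ?_) hq0 (le_of_eq ?_)
    · exact add_nonneg (mul_nonneg (sub_nonneg.2 hl1) (hp0 k)) ((Pi.single_nonneg (α := fun _ => ℝ)).2 (hu i) k)
    · rw [euclNorm_smul_add_single hpi _ (sub_nonneg.2 hl1)]
  have hsum := mem_atomicCone_mono (B := vecMulVec p (l • q + Pi.single j (v j)) +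
    vecMulVec ((1 - l) • p + Pi.single i (u i)) q) (add_mem m1 m2) hl
  rw [← hnu, ← hnv] at hsum
  convert hsum using 2
  have hsing : Matrix.single i j (u i * v j) = vecMulVec (Pi.single i (u i)) (Pi.single j (v j)) := by
    ext a b
    simp only [Matrix.single, of_apply, vecMulVec_apply, Pi.single_apply]
    grind
  rw [hsing]
  conv_lhs => rw [congrArg₂ vecMulVec hup hvq]
  ext a b
  simp only [vecMulVec_apply, Matrix.add_apply, Matrix.sub_apply, Pi.add_apply, Pi.smul_apply,
    smul_eq_mul]
  ring

theorem sub_single_mem_atomicCone {p : Matrix ι κ ℝ × ℝ} (h : p ∈ atomicCone ι κ) (i : ι) (j : κ) :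
    (p.1 - Matrix.single i j (p.1 i j), p.2 + p.1 i j) ∈ atomicCone ι κ := by
  induction h using AddSubmonoid.closure_induction with
  | mem p h =>
    obtain ⟨u, v, hu, hv, h1, h2⟩ := h
    rw [h1]
    exact mem_atomicCone_mono (vecMulVec_sub_single_mem_atomicCone hu hv i j)
      (add_le_add h2 le_rfl)
  | zero => simp [show ((0, 0) : Matrix ι κ ℝ × ℝ) ∈ atomicCone ι κ from zero_mem _]
  | add p q _ _ hp hq =>
    convert add_mem hp hq using 1
    ext a b
    · simp only [Matrix.sub_apply, Prod.fst_add, Matrix.add_apply, Matrix.single_apply]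
      split_ifs <;> ring
    · simp only [Prod.fst_add, Prod.snd_add, Matrix.add_apply]
      ring

/-- Changing one entry of a nonnegative matrix by `d` increases the cost by at most `|d|`. -/
theorem add_single_mem_atomicCone {B : Matrix ι κ ℝ} {t : ℝ} (h : (B, t) ∈ atomicCone ι κ)
    {i : ι} {j : κ} {d : ℝ} (hd : 0 ≤ B i j + d) :
    (B + Matrix.single i j d, t + |d|) ∈ atomicCone ι κ := by
  rcases le_or_gt 0 d with h0 | h0
  · rw [abs_of_nonneg h0]
    refine add_mem h (b := (Matrix.single i j d, d)) ?_
    have : Matrix.single i j d = vecMulVec (Pi.single i d) (Pi.single j (1 : ℝ)) := by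
      ext a b
      simp only [Matrix.single, of_apply, vecMulVec_apply, Pi.single_apply]
      grind
    rw [this]
    refine vecMulVec_mem_atomicCone ((Pi.single_nonneg (α := fun _ => ℝ)).2 h0)
      ((Pi.single_nonneg (α := fun _ => ℝ)).2 zero_le_one) ?_
    simp [euclNorm, Real.sqrt_mul_self h0]
  · rw [abs_of_neg h0]
    have hB : 0 < B i j := by linarith
    have h1 : 0 ≤ 1 - -d / B i j := by
      rw [sub_nonneg, div_le_one hB]; linarith
    have h2 : 0 ≤ -d / B i j := div_nonneg (by linarith) hB.le
    -- A partial decrease is a convex combination of keeping the entry and deleting it; the weight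
    -- `-d / B i j` makes the extra cost exactly `-d`.
    convert add_mem (smul_mem_atomicCone h h1)
      (smul_mem_atomicCone (sub_single_mem_atomicCone h i j) h2) using 1
    ext a b
    · simp only [Matrix.add_apply, Prod.fst_add, Prod.smul_fst, Matrix.smul_apply, smul_eq_mul,
        Matrix.sub_apply, Matrix.single_apply]
      split_ifs
      · field_simp; ring
      · ring
    · simp only [Prod.snd_add, Prod.smul_snd, smul_eq_mul]
      field_simp; ring

/-- The cost is Lipschitz for the entrywise `ℓ¹` distance on nonnegative matrices. -/
theorem mem_atomicCone_of_l1_dist {A B : Matrix ι κ ℝ} {t : ℝ} (h : (B, t) ∈ atomicCone ι κ)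
    (hA : ∀ i j, 0 ≤ A i j) : (A, t + ∑ i, ∑ j, |A i j - B i j|) ∈ atomicCone ι κ := by
  have hB := (nonneg_of_mem_atomicCone h).1
  -- Entries are replaced one at a time; each intermediate matrix mixes entries of `A` and `B`, so
  -- it stays nonnegative.
  have key : ∀ T : Finset (ι × κ), (Matrix.of fun i j => if (i, j) ∈ T then A i j else B i j,
      t + ∑ x ∈ T, |A x.1 x.2 - B x.1 x.2|) ∈ atomicCone ι κ := by
    intro T
    induction T using Finset.induction_on with
    | empty => simp only [Finset.notMem_empty, if_false, Finset.sum_empty, add_zero]; exact h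
    | insert x T hx ih =>
      convert add_single_mem_atomicCone ih (i := x.1) (j := x.2) (d := A x.1 x.2 - B x.1 x.2) ?_
        using 1
      · ext a b
        · obtain ⟨x1, x2⟩ := x
          simp only [of_apply, Matrix.add_apply, Matrix.single_apply, Finset.mem_insert,
            Prod.mk.injEq]
          grind
        · simp only [Finset.sum_insert hx]; ring
      · simp [hx, hA]
  have := key Finset.univ
  rw [Fintype.sum_prod_type] at this
  simp only [Finset.mem_univ, if_true] at this
  exact this

end DecidableEq

/-! ### Attainment of the least cost by compactness -/

/-- The rank-one matrices `u vᵀ` with `u`, `v` nonnegative and in the unit ball. -/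
def atoms (ι κ : Type*) [Fintype ι] [Fintype κ] : Set (Matrix ι κ ℝ) :=
  (fun p : (ι → ℝ) × (κ → ℝ) => vecMulVec p.1 p.2) ''
    ({u | (∀ i, 0 ≤ u i) ∧ euclNorm u ≤ 1} ×ˢ {v | (∀ j, 0 ≤ v j) ∧ euclNorm v ≤ 1})

theorem isCompact_nonneg_unitBall (ι : Type*) [Fintype ι] :
    IsCompact {u : ι → ℝ | (∀ i, 0 ≤ u i) ∧ euclNorm u ≤ 1} := by
  have hcont : Continuous (euclNorm : (ι → ℝ) → ℝ) := by
    unfold euclNorm dotProduct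
    fun_prop
  refine (isCompact_Icc (a := (0 : ι → ℝ)) (b := 1)).of_isClosed_subset ?_ ?_
  · simp only [Set.ofPred_and, Set.ofPred_forall]
    exact (isClosed_iInter fun i => isClosed_le continuous_const (continuous_apply i)).inter
      (isClosed_le hcont continuous_const)
  · rintro u ⟨h0, h1⟩
    refine ⟨h0, fun i => ?_⟩
    have h2 : u i * u i ≤ u ⬝ᵥ u :=
      Finset.single_le_sum (f := fun i => u i * u i) (fun i _ => mul_self_nonneg (u i))
        (Finset.mem_univ i)
    rw [← euclNorm_sq] at h2
    have h3 := euclNorm_nonneg u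
    simp only [Pi.one_apply]
    nlinarith

theorem isCompact_convexHull_atoms : IsCompact (convexHull ℝ (atoms ι κ)) := by
  refine IsCompact.convexHull_of_finiteDimensional
    (((isCompact_nonneg_unitBall ι).prod (isCompact_nonneg_unitBall κ)).image ?_)
  refine continuous_matrix fun i j => ?_
  simp only [vecMulVec_apply]
  fun_prop

theorem zero_mem_atoms : (0 : Matrix ι κ ℝ) ∈ atoms ι κ :=
  ⟨(0, 0), ⟨⟨fun _ => le_rfl, by simp [euclNorm]⟩, ⟨fun _ => le_rfl, by simp [euclNorm]⟩⟩, by simp⟩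

/-- This replaces decompositions of unbounded length by one point of a compact set, as needed for
attaining the minimum. -/
theorem mem_atomicCone_iff {p : Matrix ι κ ℝ × ℝ} :
    p ∈ atomicCone ι κ ↔ 0 ≤ p.2 ∧ ∃ M ∈ convexHull ℝ (atoms ι κ), p.2 • M = p.1 := by
  have h0 := subset_convexHull ℝ _ (zero_mem_atoms (ι := ι) (κ := κ))
  constructor
  · intro h
    refine ⟨(nonneg_of_mem_atomicCone h).2, ?_⟩
    induction h using AddSubmonoid.closure_induction with
    | mem p h =>
      obtain ⟨u, v, hu, hv, h1, h2⟩ := h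
      have hs := (mul_nonneg (euclNorm_nonneg u) (euclNorm_nonneg v)).trans h2
      rw [h1]
      rcases (euclNorm_nonneg u).eq_or_lt' with hu0 | hu0
      · exact ⟨0, h0, by simp [euclNorm_eq_zero.1 hu0]⟩
      rcases (euclNorm_nonneg v).eq_or_lt' with hv0 | hv0
      · exact ⟨0, h0, by ext; simp [euclNorm_eq_zero.1 hv0, vecMulVec_apply]⟩
      have hs0 : 0 < p.2 := (mul_pos hu0 hv0).trans_le h2
      have hc : 0 ≤ euclNorm v / p.2 := by positivity
      have hd : 0 ≤ (euclNorm v)⁻¹ := by positivity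
      refine ⟨_, subset_convexHull ℝ _ ⟨((euclNorm v / p.2) • u, (euclNorm v)⁻¹ • v),
        ⟨⟨fun i => mul_nonneg hc (hu i), ?_⟩, ⟨fun j => mul_nonneg hd (hv j), ?_⟩⟩, rfl⟩, ?_⟩
      · rw [euclNorm_smul hc, div_mul_eq_mul_div, div_le_one hs0, mul_comm]
        exact h2
      · rw [euclNorm_smul hd, inv_mul_cancel₀ hv0.ne']
      · ext i j
        simp only [vecMulVec_apply, Matrix.smul_apply, Pi.smul_apply, smul_eq_mul]
        field_simp
    | zero => exact ⟨0, h0, by simp⟩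
    | add p q hp' hq' hp hq =>
      obtain ⟨M, hM, hp⟩ := hp
      obtain ⟨N, hN, hq⟩ := hq
      have hp0 := (nonneg_of_mem_atomicCone hp').2
      have hq0 := (nonneg_of_mem_atomicCone hq').2
      rcases (add_nonneg hp0 hq0).eq_or_lt' with h | h
      · have h1 : p.2 = 0 := by linarith
        have h2 : q.2 = 0 := by linarith
        refine ⟨0, h0, ?_⟩
        rw [Prod.fst_add, ← hp, ← hq, h1, h2]
        simp
      · refine ⟨_, convex_convexHull ℝ (atoms ι κ) hM hN (div_nonneg hp0 h.le)
          (div_nonneg hq0 h.le) (by rw [← add_div, div_self h.ne']), ?_⟩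
        rw [Prod.snd_add, Prod.fst_add, ← hp, ← hq, smul_add, smul_smul, smul_smul,
          mul_div_cancel₀ _ h.ne', mul_div_cancel₀ _ h.ne']
  · rintro ⟨ht, M, hM, h⟩
    have hconv : Convex ℝ {M : Matrix ι κ ℝ | (M, (1 : ℝ)) ∈ atomicCone ι κ} := by
      intro M hM N hN a b ha hb hab
      have := add_mem (smul_mem_atomicCone hM ha) (smul_mem_atomicCone hN hb)
      simpa [hab] using this
    have hsub : atoms ι κ ⊆ {M : Matrix ι κ ℝ | (M, (1 : ℝ)) ∈ atomicCone ι κ} := by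
      rintro _ ⟨⟨u, v⟩, ⟨hu, hv⟩, rfl⟩
      exact vecMulVec_mem_atomicCone hu.1 hv.1
        (mul_le_one₀ hu.2 (euclNorm_nonneg v) hv.2)
    have := smul_mem_atomicCone (convexHull_min hsub hconv hM) ht
    rw [Prod.smul_mk, h, smul_eq_mul, mul_one] at this
    exact this

theorem exists_isLeast_atomicCone {A : Matrix ι κ ℝ} (hA : ∀ i j, 0 ≤ A i j) :
    ∃ t, IsLeast {t | (A, t) ∈ atomicCone ι κ} t := by
  classical
  -- Starting from the zero matrix, the Lipschitz bound gives a finite cost `T` for `A`; the search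
  -- can then be confined to `[0, T]`.
  have hne := mem_atomicCone_of_l1_dist (zero_mem (atomicCone ι κ)) hA
  set T := (0 : ℝ) + ∑ i, ∑ j, |A i j - (0 : Matrix ι κ ℝ) i j|
  have hc : IsCompact ((Set.Icc 0 T ×ˢ convexHull ℝ (atoms ι κ)) ∩
      {p : ℝ × Matrix ι κ ℝ | p.1 • p.2 = A}) :=
    (isCompact_Icc.prod isCompact_convexHull_atoms).inter_right
      (isClosed_eq (by fun_prop) continuous_const)
  obtain ⟨hT, M, hM, hMA⟩ := mem_atomicCone_iff.1 hne
  obtain ⟨⟨t, N⟩, ⟨⟨ht, hN⟩, hNA⟩, hmin⟩ := hc.exists_isMinOn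
    ⟨(T, M), ⟨⟨⟨hT, le_rfl⟩, hM⟩, hMA⟩⟩ continuous_fst.continuousOn
  refine ⟨t, mem_atomicCone_iff.2 ⟨ht.1, N, hN, hNA⟩, fun s hs => ?_⟩
  rcases le_total s T with h | h
  · obtain ⟨hs, M, hM, hMA⟩ := mem_atomicCone_iff.1 hs
    exact hmin (a := (s, M)) ⟨⟨⟨hs, h⟩, hM⟩, hMA⟩
  · exact ht.2.trans h

/-! ### Hahn–Banach and the dual certificate -/

/-- The costs of the approximate decompositions of `M`, in which the entrywise `ℓ¹` norm of the
error is added to the cost. -/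
def relaxedCosts (M : Matrix ι κ ℝ) : Set ℝ :=
  {r | ∃ B t, (B, t) ∈ atomicCone ι κ ∧ t + ∑ i, ∑ j, |M i j - B i j| ≤ r}

theorem relaxedCosts_nonempty (M : Matrix ι κ ℝ) : (relaxedCosts M).Nonempty :=
  ⟨_, 0, 0, zero_mem _, le_rfl⟩

theorem nonneg_of_mem_relaxedCosts {M : Matrix ι κ ℝ} {r : ℝ} (hr : r ∈ relaxedCosts M) :
    0 ≤ r := by
  obtain ⟨B, t, h, hr⟩ := hr
  exact (add_nonneg (nonneg_of_mem_atomicCone h).2 (by positivity)).trans hr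

theorem bddBelow_relaxedCosts (M : Matrix ι κ ℝ) : BddBelow (relaxedCosts M) :=
  ⟨0, fun _ => nonneg_of_mem_relaxedCosts⟩

theorem add_mem_relaxedCosts {M N : Matrix ι κ ℝ} {r s : ℝ} (hr : r ∈ relaxedCosts M)
    (hs : s ∈ relaxedCosts N) : r + s ∈ relaxedCosts (M + N) := by
  obtain ⟨B, t, hB, hr⟩ := hr
  obtain ⟨B', t', hB', hs⟩ := hs
  refine ⟨B + B', t + t', add_mem hB hB', ?_⟩
  have : ∑ i, ∑ j, |(M + N) i j - (B + B') i j| ≤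
      ∑ i, ∑ j, |M i j - B i j| + ∑ i, ∑ j, |N i j - B' i j| := by
    simp only [← Finset.sum_add_distrib]
    refine Finset.sum_le_sum fun i _ => Finset.sum_le_sum fun j _ => ?_
    rw [Matrix.add_apply, Matrix.add_apply, add_sub_add_comm]
    exact abs_add_le _ _
  linarith

theorem smul_mem_relaxedCosts {M : Matrix ι κ ℝ} {r c : ℝ} (hc : 0 ≤ c)
    (hr : r ∈ relaxedCosts M) : c * r ∈ relaxedCosts (c • M) := by
  obtain ⟨B, t, hB, hr⟩ := hr
  refine ⟨c • B, c * t, smul_mem_atomicCone hB hc, ?_⟩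
  simp only [Matrix.smul_apply, smul_eq_mul, ← mul_sub, abs_mul, abs_of_nonneg hc,
    ← Finset.mul_sum, ← mul_add]
  exact mul_le_mul_of_nonneg_left hr hc

/-- The largest sublinear function that is bounded by the cost on nonnegative matrices and by the
entrywise `ℓ¹` norm everywhere. -/
noncomputable def relaxedCost (M : Matrix ι κ ℝ) : ℝ := sInf (relaxedCosts M)

theorem relaxedCost_add_le (M N : Matrix ι κ ℝ) :
    relaxedCost (M + N) ≤ relaxedCost M + relaxedCost N := by
  rw [← sub_le_iff_le_add]
  refine le_csInf (relaxedCosts_nonempty M) fun r hr => ?_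
  rw [sub_le_comm]
  refine le_csInf (relaxedCosts_nonempty N) fun s hs => ?_
  have := csInf_le (bddBelow_relaxedCosts _) (add_mem_relaxedCosts hr hs)
  rw [relaxedCost]
  linarith

theorem relaxedCost_smul {c : ℝ} (hc : 0 < c) (M : Matrix ι κ ℝ) :
    relaxedCost (c • M) = c * relaxedCost M := by
  have key : ∀ {c : ℝ} (_ : 0 < c) (M : Matrix ι κ ℝ),
      relaxedCost (c • M) ≤ c * relaxedCost M := by
    intro c hc M
    rw [← div_le_iff₀' hc]
    refine le_csInf (relaxedCosts_nonempty M) fun r hr => ?_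
    rw [div_le_iff₀' hc]
    exact csInf_le (bddBelow_relaxedCosts _) (smul_mem_relaxedCosts hc.le hr)
  refine le_antisymm (key hc M) ?_
  have := key (inv_pos.2 hc) (c • M)
  rw [inv_smul_smul₀ hc.ne', le_inv_mul_iff₀ hc] at this
  exact this

theorem relaxedCost_vecMulVec_le {u : ι → ℝ} {v : κ → ℝ} (hu : ∀ i, 0 ≤ u i) (hv : ∀ j, 0 ≤ v j) :
    relaxedCost (vecMulVec u v) ≤ euclNorm u * euclNorm v :=
  csInf_le (bddBelow_relaxedCosts _) ⟨_, _, vecMulVec_mem_atomicCone hu hv le_rfl, by simp⟩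

/-- A dual certificate for the least cost of a nonnegative matrix. -/
theorem exists_dual_functional {A : Matrix ι κ ℝ} (hA : ∀ i j, 0 ≤ A i j) {t : ℝ}
    (ht : IsLeast {t | (A, t) ∈ atomicCone ι κ} t) :
    ∃ g : Matrix ι κ ℝ →ₗ[ℝ] ℝ, g A = t ∧ ∀ u v, (∀ i, 0 ≤ u i) → (∀ j, 0 ≤ v j) →
      g (vecMulVec u v) ≤ euclNorm u * euclNorm v := by
  classical
  have ht0 : 0 ≤ t := (nonneg_of_mem_atomicCone ht.1).2
  -- The functional `c • A ↦ c * t` is well defined even for `A = 0`, since then `t = 0`.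
  have hzero : ∀ c : ℝ, c • A = 0 → (RingHom.id ℝ) c • t = 0 := by
    intro c hc
    rcases smul_eq_zero.1 hc with rfl | rfl
    · simp
    · rw [le_antisymm (ht.2 (zero_mem (atomicCone ι κ))) ht0, smul_zero]
  obtain ⟨g, hg, hgN⟩ := exists_extension_of_le_sublinear
    (LinearPMap.mkSpanSingleton' A t hzero) relaxedCost (fun c hc M => relaxedCost_smul hc M)
    relaxedCost_add_le (by
      rintro ⟨x, hx⟩
      obtain ⟨c, rfl⟩ := Submodule.mem_span_singleton.1 hx
      rw [LinearPMap.mkSpanSingleton'_apply]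
      refine le_csInf (relaxedCosts_nonempty _) fun r hr => ?_
      rw [RingHom.id_apply, smul_eq_mul]
      rcases le_or_gt c 0 with hc | hc
      · exact (mul_nonpos_of_nonpos_of_nonneg hc ht0).trans (nonneg_of_mem_relaxedCosts hr)
      · obtain ⟨B, s, hB, hr⟩ := hr
        -- The Lipschitz bound turns an approximate decomposition of `c • A` into an exact one of no
        -- larger cost than `r`.
        have h1 := mem_atomicCone_mono (mem_atomicCone_of_l1_dist hB (A := c • A)
          fun i j => mul_nonneg hc.le (hA i j)) hr
        have h2 := smul_mem_atomicCone h1 (inv_nonneg.2 hc.le)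
        rw [Prod.smul_mk, inv_smul_smul₀ hc.ne', smul_eq_mul] at h2
        exact (le_inv_mul_iff₀ hc).1 (ht.2 h2))
  refine ⟨g, ?_, fun u v hu hv => (hgN _).trans (relaxedCost_vecMulVec_le hu hv)⟩
  rw [← LinearPMap.mkSpanSingleton'_apply_self A t hzero (Submodule.mem_span_singleton_self A)]
  exact hg ⟨A, Submodule.mem_span_singleton_self A⟩

/-! ### The three programs -/

variable {m n : ℕ}

theorem exists_mem_nonnegNuclearValues_le {p : Matrix (Fin m) (Fin n) ℝ × ℝ}
    (h : p ∈ atomicCone (Fin m) (Fin n)) : ∃ t ∈ nonnegNuclearValues p.1, t ≤ p.2 := by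
  induction h using AddSubmonoid.closure_induction with
  | mem p h =>
    obtain ⟨u, v, hu, hv, h1, h2⟩ := h
    refine ⟨_, ⟨1, fun _ => WithLp.toLp 2 u, fun _ => WithLp.toLp 2 v, fun _ => hu, fun _ => hv,
      by simpa using h1, rfl⟩, ?_⟩
    simpa [← euclNorm_eq_norm] using h2
  | zero => exact ⟨0, ⟨0, Fin.elim0, Fin.elim0, fun k => k.elim0, fun k => k.elim0, by simp,
      by simp⟩, le_rfl⟩
  | add p q _ _ hp hq =>
    obtain ⟨_, ⟨r, u, v, hu, hv, hA, rfl⟩, hp⟩ := hp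
    obtain ⟨_, ⟨r', u', v', hu', hv', hA', rfl⟩, hq⟩ := hq
    refine ⟨_, ⟨r + r', Fin.append u u', Fin.append v v', ?_, ?_, ?_, rfl⟩, ?_⟩
    · intro k
      induction k using Fin.addCases with
      | left k => simpa using hu k
      | right k => simpa using hu' k
    · intro k
      induction k using Fin.addCases with
      | left k => simpa using hv k
      | right k => simpa using hv' k
    · simp [Fin.sum_univ_add, hA, hA']
    · simpa [Fin.sum_univ_add] using add_le_add hp hq

theorem nonnegNuclearValues_subset_completelyPositiveValues (A : Matrix (Fin m) (Fin n) ℝ) :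
    nonnegNuclearValues A ⊆ completelyPositiveValues A := by
  rintro _ ⟨r, u, v, hu, hv, hA, rfl⟩
  -- The factors bring both vectors to norm `√(‖u k‖ * ‖v k‖)`. If either vector is zero, division
  -- by zero makes `c k = d k = 0`, which drops the term harmlessly.
  set c : Fin r → ℝ := fun k => √(‖v k‖ / ‖u k‖) with hc
  set d : Fin r → ℝ := fun k => √(‖u k‖ / ‖v k‖) with hd
  have hc2 : ∀ k, c k ^ 2 * ‖u k‖ ^ 2 = ‖u k‖ * ‖v k‖ := by
    intro k
    rw [hc, Real.sq_sqrt (by positivity)]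
    rcases eq_or_ne ‖u k‖ 0 with h | h
    · simp [h]
    · field_simp
  have hd2 : ∀ k, d k ^ 2 * ‖v k‖ ^ 2 = ‖u k‖ * ‖v k‖ := by
    intro k
    rw [hd, Real.sq_sqrt (by positivity)]
    rcases eq_or_ne ‖v k‖ 0 with h | h
    · simp [h]
    · field_simp
  have hcd : ∀ k i j, (c k * u k i) * (d k * v k j) = u k i * v k j := by
    intro k i j
    rcases eq_or_ne (u k) 0 with h | h
    · simp [h]
    rcases eq_or_ne (v k) 0 with h' | h'
    · simp [h']
    have hu0 := norm_ne_zero_iff.2 h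
    have hv0 := norm_ne_zero_iff.2 h'
    have : c k * d k = 1 := by
      rw [hc, hd, ← Real.sqrt_mul (by positivity), div_mul_div_cancel₀ hu0, div_self hv0,
        Real.sqrt_one]
    linear_combination (u k i * v k j) * this
  let U : Matrix (Fin m) (Fin r) ℝ := Matrix.of fun i k => c k * u k i
  let V : Matrix (Fin n) (Fin r) ℝ := Matrix.of fun j k => d k * v k j
  have hUV : A = U * Vᵀ := by
    rw [hA]
    ext i j
    simp [U, V, Matrix.mul_apply, Matrix.sum_apply, vecMulVec_apply, hcd]
  have hUtr : (U * Uᵀ).trace = ∑ k, ‖u k‖ * ‖v k‖ := by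
    simp only [Matrix.trace, Matrix.diag, Matrix.mul_apply, Matrix.transpose_apply]
    rw [Finset.sum_comm]
    refine Finset.sum_congr rfl fun k _ => ?_
    rw [← hc2, EuclideanSpace.real_norm_sq_eq, Finset.mul_sum]
    exact Finset.sum_congr rfl fun i _ => by simp only [U, of_apply]; ring
  have hVtr : (V * Vᵀ).trace = ∑ k, ‖u k‖ * ‖v k‖ := by
    simp only [Matrix.trace, Matrix.diag, Matrix.mul_apply, Matrix.transpose_apply]
    rw [Finset.sum_comm]
    refine Finset.sum_congr rfl fun k _ => ?_
    rw [← hd2, EuclideanSpace.real_norm_sq_eq, Finset.mul_sum]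
    exact Finset.sum_congr rfl fun i _ => by simp only [V, of_apply]; ring
  refine ⟨U * Uᵀ, V * Vᵀ, ⟨r, Matrix.fromRows U V, ?_, ?_⟩, ?_⟩
  · rintro (i | j) k
    · exact mul_nonneg (Real.sqrt_nonneg _) (hu k i)
    · exact mul_nonneg (Real.sqrt_nonneg _) (hv k j)
  · rw [Matrix.transpose_fromRows, Matrix.fromRows_mul_fromCols, hUV, Matrix.transpose_mul,
      Matrix.transpose_transpose]
  · rw [hUtr, hVtr]
    ring

theorem dotProduct_fromBlocks_one_mulVec (W : Matrix (Fin m) (Fin n) ℝ)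
    (x : Fin m ⊕ Fin n → ℝ) :
    x ⬝ᵥ (fromBlocks 1 (-W) (-Wᵀ) 1).mulVec x =
      ∑ i, x (.inl i) ^ 2 + ∑ j, x (.inr j) ^ 2 -
        2 * ∑ i, ∑ j, x (.inl i) * x (.inr j) * W i j := by
  have h1 : ∑ i, x (.inl i) * (W *ᵥ (x ∘ Sum.inr)) i =
      ∑ i, ∑ j, x (.inl i) * x (.inr j) * W i j := by
    refine Finset.sum_congr rfl fun i _ => ?_
    rw [mulVec, dotProduct, Finset.mul_sum]
    exact Finset.sum_congr rfl fun j _ => by simp only [Function.comp_apply]; ring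
  have h2 : ∑ j, x (.inr j) * (Wᵀ *ᵥ (x ∘ Sum.inl)) j =
      ∑ i, ∑ j, x (.inl i) * x (.inr j) * W i j := by
    rw [Finset.sum_comm]
    refine Finset.sum_congr rfl fun j _ => ?_
    rw [mulVec, dotProduct, Finset.mul_sum]
    exact Finset.sum_congr rfl fun i _ => by
      simp only [Function.comp_apply, transpose_apply]; ring
  rw [dotProduct, Fintype.sum_sum_type]
  simp only [fromBlocks_mulVec, Sum.elim_inl, Sum.elim_inr, one_mulVec, neg_mulVec, Pi.add_apply,
    Pi.neg_apply, Function.comp_apply, mul_add, mul_neg, Finset.sum_add_distrib,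
    Finset.sum_neg_distrib, h1, h2, sq]
  ring

/-- Weak duality. -/
theorem le_of_mem_copositiveValues_of_mem_completelyPositiveValues
    {A : Matrix (Fin m) (Fin n) ℝ} {s t : ℝ} (hs : s ∈ copositiveValues A)
    (ht : t ∈ completelyPositiveValues A) : s ≤ t := by
  obtain ⟨W, hW, rfl⟩ := hs
  obtain ⟨X, Y, ⟨r, B, hB, hXY⟩, rfl⟩ := ht
  have hX : X.trace = ∑ k, ∑ i, B (.inl i) k ^ 2 := by
    rw [Finset.sum_comm]
    refine Finset.sum_congr rfl fun i _ => ?_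
    simpa [Matrix.mul_apply, sq] using congrFun₂ hXY (.inl i) (.inl i)
  have hY : Y.trace = ∑ k, ∑ j, B (.inr j) k ^ 2 := by
    rw [Finset.sum_comm]
    refine Finset.sum_congr rfl fun i _ => ?_
    simpa [Matrix.mul_apply, sq] using congrFun₂ hXY (.inr i) (.inr i)
  have hA : ∑ i, ∑ j, A i j * W i j =
      ∑ k, ∑ i, ∑ j, B (.inl i) k * B (.inr j) k * W i j := by
    have hAB : ∀ i j, A i j = ∑ k, B (.inl i) k * B (.inr j) k := fun i j => by
      simpa [Matrix.mul_apply] using congrFun₂ hXY (.inl i) (.inr j)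
    simp only [hAB, Finset.sum_mul]
    symm
    rw [Finset.sum_comm]
    exact Finset.sum_congr rfl fun i _ => Finset.sum_comm
  have h : 0 ≤ ∑ k, (fun x => B x k) ⬝ᵥ (fromBlocks 1 (-W) (-Wᵀ) 1).mulVec fun x => B x k :=
    Finset.sum_nonneg fun k _ => hW.2 (fun x => B x k) fun x => hB x k
  simp only [dotProduct_fromBlocks_one_mulVec, Finset.sum_sub_distrib, Finset.sum_add_distrib,
    ← Finset.mul_sum] at h
  rw [hX, hY, hA]
  linarith

/-- The matrix `W` represents `g` in the standard basis. Copositivity follows from `2‖u‖‖v‖ ≤ ‖u‖² +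
‖v‖²` for the two blocks `u`, `v` of `x`. -/
theorem mem_copositiveValues_of_functional (A : Matrix (Fin m) (Fin n) ℝ)
    {g : Matrix (Fin m) (Fin n) ℝ →ₗ[ℝ] ℝ}
    (hg : ∀ u v, (∀ i, 0 ≤ u i) → (∀ j, 0 ≤ v j) → g (vecMulVec u v) ≤ euclNorm u * euclNorm v) :
    g A ∈ copositiveValues A := by
  have hgM : ∀ M, g M = ∑ i, ∑ j, M i j * g (Matrix.single i j 1) := by
    intro M
    conv_lhs => rw [matrix_eq_sum_single M]
    simp only [map_sum]
    refine Finset.sum_congr rfl fun i _ => Finset.sum_congr rfl fun j _ => ?_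
    rw [← smul_eq_mul, ← map_smul, Matrix.smul_single, smul_eq_mul, mul_one]
  refine ⟨Matrix.of fun i j => g (Matrix.single i j 1), ⟨?_, fun x hx => ?_⟩, hgM A⟩
  · rw [Matrix.IsSymm, fromBlocks_transpose, transpose_one, transpose_one, transpose_neg,
      transpose_neg, transpose_transpose]
  · rw [dotProduct_fromBlocks_one_mulVec]
    have h := hg (x ∘ Sum.inl) (x ∘ Sum.inr) (fun i => hx _) (fun j => hx _)
    rw [hgM] at h
    simp only [vecMulVec_apply, Function.comp_apply] at h
    have hu := euclNorm_sq (x ∘ Sum.inl)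
    have hv := euclNorm_sq (x ∘ Sum.inr)
    simp only [dotProduct, Function.comp_apply, ← sq] at hu hv
    simp only [of_apply]
    rw [← hu, ← hv]
    nlinarith [sq_nonneg (euclNorm (x ∘ Sum.inl) - euclNorm (x ∘ Sum.inr))]

end NonnegNuclear

open NonnegNuclear in
theorem theorem3 {m n : ℕ} (A : Matrix (Fin m) (Fin n) ℝ) (hA : ∀ i j, 0 ≤ A i j) :
    IsLeast (nonnegNuclearValues A) (nuPlus A) ∧
    IsLeast (completelyPositiveValues A) (nuPlus A) ∧
    IsGreatest (copositiveValues A) (nuPlus A) := by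
  obtain ⟨t, ht⟩ := exists_isLeast_atomicCone hA
  obtain ⟨g, hgA, hg⟩ := exists_dual_functional hA ht
  have hdual : t ∈ copositiveValues A := hgA ▸ mem_copositiveValues_of_functional A hg
  obtain ⟨s, hs, hst⟩ := exists_mem_nonnegNuclearValues_le ht.1
  have hsub := nonnegNuclearValues_subset_completelyPositiveValues A
  -- The decomposition value `s` is at most `t`, and weak duality against the certificate gives `t ≤
  -- s`.
  obtain rfl : s = t := le_antisymm hst
    (le_of_mem_copositiveValues_of_mem_completelyPositiveValues hdual (hsub hs))
  have hgreat : IsGreatest (copositiveValues A) s := ⟨hdual, fun _ h =>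
    le_of_mem_copositiveValues_of_mem_completelyPositiveValues h (hsub hs)⟩
  have hleast : IsLeast (completelyPositiveValues A) s := ⟨hsub hs, fun _ h =>
    le_of_mem_copositiveValues_of_mem_completelyPositiveValues hdual h⟩
  rw [nuPlus, hgreat.csSup_eq]
  exact ⟨⟨hs, fun _ h => hleast.2 (hsub h)⟩, hleast, hgreat⟩
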